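/- Let $A$ be a finite alphabet, and let $X\subset A^{\mathbb Z}$ be a subshift, i.e. a closed subset invariant under all powers of the shift $(\sigma x)(m)=x(m+1)$. The language $\mathcal L(X)$ is the set of all finite words (including the empty word) that appear in points of $X$; $|w|$ is the length of a word $w$, and $d_H(v,w)=|\{i: v(i)\ne w(i)\}|$ is the Hamming distance between two words of equal length. For a function $g:\{0,1,2,\dots\}\to\mathbb R$, a subshift $X$ has almost specification with mistake function $g$ if $g(n)/n\to 0$ as $n\to\infty$ and if for every $k\ge 1$ and all words $w^{(1)},\dots,w^{(k)}\in\mathcal L(X)$ there are words $\bar w^{(1)},\dots,\bar w^{(k)}\in\mathcal L(X)$ with $|\bar w^{(i)}|=|w^{(i)}|$ and $d_H(\bar w^{(i)},w^{(i)})\le g(|w^{(i)}|)$ for $1\le i\le k$, such that the concatenation $\bar w^{(1)}\bar w^{(2)}\cdots\bar w^{(k)}$ is in $\mathcal L(X)$. A subshift $X$ is irreducible if for all $u,v\in\mathcal L(X)$ there is a (possibly empty) word $w$ with $uwv\in\mathcal L(X)$. The measure center $\hat X$ of $X$ is the union of the supports of all $\sigma$-invariant Borel probability measures $\mu$ on $A^{\mathbb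 Z}$ with $\mu(X)=1$; it is a closed, shift-invariant subset of $X$, hence itself a subshift. Theorem. If $X$ has almost specification with mistake function $g$, then its measure center $\hat X$ is irreducible and has almost specification with the same mistake function $g$. -/

import Mathlib

open SymbolicDynamics.FullShift MeasureTheory Filter Topology

namespace SymbolicDynamics.FullShift

/-- `u` and `w` are words of the same length that differ in at most `r` positions. -/
def HammingClose {A : Type*} (u w : List A) (r : ℝ) : Prop :=
  ∃ h : u.length = w.length,
    letI : DecidableEq A := Classical.decEq A
    (hammingDist (fun i : Fin w.length => u.get (i.cast h.symm)) (fun i => w.get i) : ℝ) ≤ r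

namespace Subshift

variable {A : Type*} [TopologicalSpace A]

/-- The language of `X`: all finite words (the empty one included) that appear in points of `X`. -/
def language (X : Subshift A ℤ) : Set (List A) :=
  {w | ∃ x ∈ X.carrier, ∃ i : ℤ, ∀ j : Fin w.length, x (i + (j : ℕ)) = w.get j}

/-- `X` is irreducible: any two words `u`, `v` of the language can be joined by some word `w`
to a word `uwv` of the language. -/
def IsIrreducible (X : Subshift A ℤ) : Prop :=
  ∀ u ∈ X.language, ∀ v ∈ X.language, ∃ w : List A, u ++ w ++ v ∈ X.language

/-- `X` has almost specification with mistake function `g`. The list `ws` plays the role of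
`w⁽¹⁾, …, w⁽ᵏ⁾` with `k ≥ 1`, and the list `ws'` that of the modified words. -/
def HasAlmostSpecification (X : Subshift A ℤ) (g : ℕ → ℝ) : Prop :=
  Tendsto (fun n : ℕ => g n / n) atTop (𝓝 0) ∧
    ∀ ws : List (List A), ws ≠ [] → (∀ w ∈ ws, w ∈ X.language) →
      ∃ ws' : List (List A),
        List.Forall₂ (fun w' w => w' ∈ X.language ∧ HammingClose w' w (g w.length)) ws' ws ∧
          ws'.flatten ∈ X.language

/-- The shift-invariant Borel probability measures on the full shift that give full weight
to `X`. -/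
def invariantMeasures [MeasurableSpace A] (X : Subshift A ℤ) : Set (Measure (ℤ → A)) :=
  {μ | IsProbabilityMeasure μ ∧ MeasurePreserving (shift (1 : ℤ)) μ μ ∧ μ X.carrierᶜ = 0}

section MeasureCenter

variable [MeasurableSpace A] [BorelSpace A]

theorem measurePreserving_shift [SecondCountableTopology A] {μ : Measure (ℤ → A)}
    (h : MeasurePreserving (shift (1 : ℤ)) μ μ) (n : ℤ) : MeasurePreserving (shift n) μ μ := by
  have hmeas : ∀ n : ℤ, Measurable (shift n : (ℤ → A) → (ℤ → A)) :=
    fun n => (continuous_shift n).measurable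
  have hcomp : ∀ m n : ℤ, (shift m : (ℤ → A) → (ℤ → A)) ∘ shift n = shift (n + m) :=
    fun m n => funext fun x => (shift_add n m x).symm
  have hneg : MeasurePreserving (shift (-1 : ℤ)) μ μ := by
    refine ⟨hmeas _, ?_⟩
    conv_lhs => rw [← h.map_eq]
    rw [Measure.map_map (hmeas _) (hmeas _), hcomp]
    have : (shift ((1 : ℤ) + -1) : (ℤ → A) → (ℤ → A)) = id := by
      funext x; simp
    rw [this, Measure.map_id]
  induction n using Int.induction_on with
  | zero =>
    have : (shift (0 : ℤ) : (ℤ → A) → (ℤ → A)) = id := by funext x; simp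
    rw [this]; exact MeasurePreserving.id μ
  | succ k ih => rw [← hcomp]; exact h.comp ih
  | pred k ih => rw [sub_eq_add_neg, ← hcomp]; exact hneg.comp ih

theorem isClosed_iUnion_support [SecondCountableTopology A] (X : Subshift A ℤ) :
    IsClosed (⋃ μ ∈ X.invariantMeasures, μ.support) := by
  rw [← closure_subset_iff_isClosed]
  intro x hx
  obtain ⟨U, hU⟩ := (𝓝 x).exists_antitone_basis
  have key : ∀ n, ∃ μ ∈ X.invariantMeasures, 0 < μ (U n) := by
    intro n
    obtain ⟨V, hVU, hVo, hxV⟩ := mem_nhds_iff.1 (hU.1.mem_of_mem (i := n) trivial)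
    obtain ⟨y, hyV, hy⟩ := mem_closure_iff.1 hx V hVo hxV
    simp only [Set.mem_iUnion] at hy
    obtain ⟨μ, hμ, hyμ⟩ := hy
    refine ⟨μ, hμ, lt_of_lt_of_le ?_ (measure_mono hVU)⟩
    exact ((𝓝 y).basis_sets.mem_measureSupport.1 hyμ) V (hVo.mem_nhds hyV)
  choose μ hμ hpos using key
  set ν : Measure (ℤ → A) := Measure.sum fun n => ((2 : ENNReal)⁻¹ ^ (n + 1)) • μ n with hν
  have hνX : ν ∈ X.invariantMeasures := by
    refine ⟨⟨?_⟩, ⟨(continuous_shift _).measurable, ?_⟩, ?_⟩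
    · rw [hν, Measure.sum_apply _ MeasurableSet.univ]
      have : ∀ n, μ n Set.univ = 1 := fun n => (hμ n).1.measure_univ
      simp only [Measure.smul_apply, this, smul_eq_mul, mul_one]
      rw [ENNReal.tsum_geometric_add_one, ENNReal.one_sub_inv_two, inv_inv]
      exact ENNReal.inv_mul_cancel (by simp) (by simp)
    · rw [hν, Measure.map_sum (continuous_shift _).measurable.aemeasurable]
      congr 1
      funext n
      rw [Measure.map_smul, (hμ n).2.1.map_eq]
    · rw [hν, Measure.sum_apply _ X.isClosed.measurableSet.compl]
      simp [(hμ _).2.2]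
  refine Set.mem_biUnion hνX ?_
  refine hU.1.mem_measureSupport.2 fun n _ => ?_
  refine lt_of_lt_of_le ?_ (Measure.le_sum_apply _ _)
  refine lt_of_lt_of_le ?_ (ENNReal.le_tsum n)
  simp only [Measure.smul_apply, smul_eq_mul]
  exact ENNReal.mul_pos (by simp) (hpos n).ne'

theorem mapsTo_iUnion_support [SecondCountableTopology A] (X : Subshift A ℤ) (n : ℤ) :
    Set.MapsTo (shift n) (⋃ μ ∈ X.invariantMeasures, μ.support)
      (⋃ μ ∈ X.invariantMeasures, μ.support) := by
  intro x hx
  simp only [Set.mem_iUnion] at hx ⊢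
  obtain ⟨μ, hμ, hxμ⟩ := hx
  refine ⟨μ, hμ, (𝓝 _).basis_sets.mem_measureSupport.2 fun V hV => ?_⟩
  obtain ⟨W, hWV, hWo, hxW⟩ := mem_nhds_iff.1 hV
  refine lt_of_lt_of_le ?_ (measure_mono hWV)
  rw [← (measurePreserving_shift hμ.2.1 n).measure_preimage hWo.measurableSet.nullMeasurableSet]
  exact ((𝓝 x).basis_sets.mem_measureSupport.1 hxμ) _
    ((hWo.preimage (continuous_shift n)).mem_nhds hxW)

/-- The measure center of `X`: the union of the supports of all invariant measures on `X`. -/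
def measureCenter [SecondCountableTopology A] (X : Subshift A ℤ) : Subshift A ℤ where
  carrier := ⋃ μ ∈ X.invariantMeasures, μ.support
  isClosed := isClosed_iUnion_support X
  mapsTo := mapsTo_iUnion_support X

end MeasureCenter

end Subshift

end SymbolicDynamics.FullShift

/-! The heart is that a list of words of `X` can be modified so that its concatenation is in the
language of the measure center. Almost specification applied to many copies of the list gives long
words of `X` tiled by modified concatenations, all of one length. By compactness, the points of `X`
with such a block in every window of bounded size form a nonempty subshift. It carries an invariant
measure, whose support lies in the measure center, so some modified concatenation occurs there.
Almost specification of the center follows at once.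

For irreducibility, a word `u` of the center has positive frequency in arbitrarily long words of
`X`, whereas mistakes have density tending to zero and each spoils at most `u.length` occurrences.
So `u` survives every allowed modification of some long `U`. Treating `v` likewise with `V` and
concatenating `[U, V]` joins `u` to `v`. -/

/-! ### Existence of invariant measures -/

/-- **Krylov–Bogolyubov theorem**: a continuous self-map of a nonempty compact space has an
invariant Borel probability measure. -/
theorem exists_isProbabilityMeasure_measurePreserving {E : Type*} [TopologicalSpace E]
    [CompactSpace E] [T2Space E] [HasOuterApproxClosed E] [MeasurableSpace E] [BorelSpace E]
    [Nonempty E] {T : E → E} (hT : Continuous T) :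
    ∃ μ : Measure E, IsProbabilityMeasure μ ∧ MeasurePreserving T μ μ := by
  obtain ⟨x⟩ := ‹Nonempty E›
  let m : ℕ → Measure E := fun n =>
    ((n + 1 : ℕ) : ENNReal)⁻¹ • ∑ i ∈ Finset.range (n + 1), Measure.dirac (T^[i] x)
  have hm : ∀ n, IsProbabilityMeasure (m n) := fun n => by
    constructor
    simp only [m, Measure.smul_apply, Measure.finsetSum_apply, measure_univ, Finset.sum_const,
      Finset.card_range, smul_eq_mul, nsmul_eq_mul, mul_one]
    exact ENNReal.inv_mul_cancel (by simp) (ENNReal.natCast_ne_top _)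
  have hint : ∀ (f : BoundedContinuousFunction E ℝ) (n : ℕ),
      ∫ y, f y ∂(m n) = birkhoffAverage ℝ T f (n + 1) x := fun f n => by
    have : ∀ i ∈ Finset.range (n + 1), Integrable f (Measure.dirac (T^[i] x)) :=
      fun i _ => f.integrable _
    rw [integral_smul_measure, integral_finsetSum_measure this]
    have hn : ((n + 1 : ℕ) : ENNReal)⁻¹.toReal = ((n + 1 : ℕ) : ℝ)⁻¹ := by
      rw [ENNReal.toReal_inv, ENNReal.toReal_natCast]
    rw [hn]
    simp [birkhoffAverage, birkhoffSum, integral_dirac]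
  let ν : ℕ → ProbabilityMeasure E := fun n => ⟨m n, hm n⟩
  -- Compactness of the space of probability measures gives a limit along an ultrafilter, with no
  -- subsequence to extract.
  obtain ⟨μ, -, hμ⟩ := isCompact_univ.ultrafilter_le_nhds ((hyperfilter ℕ).map ν) (by simp)
  have hμ' : Tendsto ν (hyperfilter ℕ) (𝓝 μ) := hμ
  rw [ProbabilityMeasure.tendsto_iff_forall_integral_tendsto] at hμ'
  have : IsProbabilityMeasure ((μ : Measure E).map T) :=
    Measure.isProbabilityMeasure_map hT.measurable.aemeasurable
  refine ⟨μ, inferInstance, hT.measurable, ?_⟩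
  refine ext_of_forall_integral_eq_of_IsFiniteMeasure fun f => ?_
  rw [integral_map hT.measurable.aemeasurable f.continuous.aestronglyMeasurable]
  have h1 := hμ' (f.compContinuous ⟨T, hT⟩)
  have h2 := hμ' f
  -- The two Birkhoff sums telescope to two boundary terms, and `f` is bounded.
  have h0 : Tendsto (fun n => birkhoffAverage ℝ T f (n + 1) (T x) -
      birkhoffAverage ℝ T f (n + 1) x) (hyperfilter ℕ) (𝓝 0) := by
    have := tendsto_birkhoffAverage_apply_sub_birkhoffAverage' ℝ (f := T) (g := f)
      f.isBounded_range x
    exact ((tendsto_add_atTop_iff_nat 1).2 this).mono_left Nat.hyperfilter_le_atTop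
  have h3 := h1.sub h2
  have heq : ∀ n, ∫ y, f.compContinuous ⟨T, hT⟩ y ∂(ν n : Measure E) - ∫ y, f y ∂(ν n : Measure E)
      = birkhoffAverage ℝ T f (n + 1) (T x) - birkhoffAverage ℝ T f (n + 1) x := fun n => by
    change ∫ y, _ ∂(m n) - ∫ y, _ ∂(m n) = _
    rw [hint, hint]
    congr 1
    simp only [birkhoffAverage, birkhoffSum, BoundedContinuousFunction.compContinuous_apply,
      ContinuousMap.coe_mk, (Function.Commute.iterate_self T _).eq]
  simp only [heq] at h3
  exact sub_eq_zero.1 (tendsto_nhds_unique h3 h0)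

namespace SymbolicDynamics.FullShift.Subshift

variable {A : Type*} [Finite A] [TopologicalSpace A] [DiscreteTopology A]
  [MeasurableSpace A] [BorelSpace A]

theorem exists_mem_invariantMeasures (Y : Subshift A ℤ) (hY : Y.carrier.Nonempty) :
    Y.invariantMeasures.Nonempty := by
  have : CompactSpace Y.carrier := isCompact_iff_compactSpace.1 Y.isClosed.isCompact
  have : Nonempty Y.carrier := hY.to_subtype
  let _ : MetricSpace (ℤ → A) := TopologicalSpace.metrizableSpaceMetric _
  obtain ⟨μ, hμ, hT⟩ := exists_isProbabilityMeasure_measurePreserving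
    ((continuous_shift (A := A) (1 : ℤ)).restrict (Y.mapsTo 1))
  have hval : Measurable (Subtype.val : Y.carrier → ℤ → A) := measurable_subtype_coe
  have hS : Measurable (shift (1 : ℤ) : (ℤ → A) → ℤ → A) := (continuous_shift 1).measurable
  refine ⟨μ.map Subtype.val, Measure.isProbabilityMeasure_map hval.aemeasurable, ⟨hS, ?_⟩, ?_⟩
  · conv_rhs => rw [← hT.map_eq]
    rw [Measure.map_map hS hval, Measure.map_map hval hT.measurable]
    rfl
  · rw [Measure.map_apply hval Y.isClosed.measurableSet.compl]
    simp

/-- An invariant measure on `Y` is also one on `X`, and its support lies in the closed set `Y`. -/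
theorem exists_mem_measureCenter (X Y : Subshift A ℤ) (hYX : Y.carrier ⊆ X.carrier)
    (hY : Y.carrier.Nonempty) : ∃ y ∈ Y.carrier, y ∈ X.measureCenter.carrier := by
  obtain ⟨μ, hμ, hT, h0⟩ := Y.exists_mem_invariantMeasures hY
  obtain ⟨y, hy⟩ := Measure.nonempty_support (IsProbabilityMeasure.ne_zero μ)
  refine ⟨y, Measure.support_subset_of_isClosed Y.isClosed h0 hy, ?_⟩
  exact Set.mem_biUnion
    ⟨hμ, hT, measure_mono_null (Set.compl_subset_compl.2 hYX) h0⟩ hy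

theorem measureCenter_subset (X : Subshift A ℤ) : X.measureCenter.carrier ⊆ X.carrier :=
  Set.iUnion₂_subset fun _ hμ => Measure.support_subset_of_isClosed X.isClosed hμ.2.2

end SymbolicDynamics.FullShift.Subshift

/-! ### Words, Hamming distance and languages -/

namespace SymbolicDynamics.FullShift

section Words

variable {A : Type*}

/-- The word of length `n` that appears in `x` at position `i`. -/
def wordAt (x : ℤ → A) (i : ℤ) (n : ℕ) : List A := List.ofFn fun j : Fin n => x (i + (j : ℕ))

@[simp] theorem length_wordAt (x : ℤ → A) (i : ℤ) (n : ℕ) : (wordAt x i n).length = n := by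
  simp [wordAt]

theorem wordAt_add (x : ℤ → A) (i : ℤ) (m n : ℕ) :
    wordAt x i (m + n) = wordAt x i m ++ wordAt x (i + m) n := by
  simp [wordAt, List.ofFn_add, add_assoc]

theorem wordAt_shift (k : ℤ) (x : ℤ → A) (i : ℤ) (n : ℕ) :
    wordAt (shift k x) i n = wordAt x (k + i) n := by
  simp [wordAt, add_assoc]

theorem wordAt_eq_iff {x y : ℤ → A} {i j : ℤ} {n : ℕ} :
    wordAt x i n = wordAt y j n ↔ ∀ k < n, x (i + (k : ℕ)) = y (j + (k : ℕ)) := by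
  simp [wordAt, List.ofFn_inj, funext_iff, Fin.forall_iff]

theorem wordAt_infix (x : ℤ → A) {i n k m : ℕ} (h : k + m ≤ n) :
    wordAt x (i + k : ℕ) m <:+: wordAt x i n := by
  obtain ⟨r, rfl⟩ := Nat.exists_eq_add_of_le h
  rw [wordAt_add, wordAt_add]
  exact ⟨_, _, by push_cast; rfl⟩

theorem wordAt_eq_append {x : ℤ → A} {i : ℤ} {v w : List A}
    (h : wordAt x i (v ++ w).length = v ++ w) :
    wordAt x i v.length = v ∧ wordAt x (i + v.length) w.length = w := by
  rw [List.length_append, wordAt_add] at h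
  exact List.append_inj h (by simp)

theorem HammingClose.length_eq {u w : List A} {r : ℝ} (h : HammingClose u w r) :
    u.length = w.length := h.1

theorem HammingClose.card_le [DecidableEq A] {x y : ℤ → A} {n : ℕ} {r : ℝ}
    (h : HammingClose (wordAt y 0 n) (wordAt x 0 n) r) :
    (((Finset.range n).filter fun i : ℕ => y i ≠ x i).card : ℝ) ≤ r := by
  obtain ⟨h, hd⟩ := h
  have hd : (hammingDist (fun i : Fin (wordAt x 0 n).length => (wordAt y 0 n).get (i.cast h.symm))
      (fun i => (wordAt x 0 n).get i) : ℝ) ≤ r := by convert hd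
  unfold hammingDist at hd
  refine le_trans (Nat.cast_le.2 ?_) hd
  refine Finset.card_le_card_of_surjOn (fun j => (j : ℕ)) ?_
  intro i hi
  rw [Finset.mem_coe, Finset.mem_filter, Finset.mem_range] at hi
  refine ⟨⟨i, by simpa using hi.1⟩, ?_, rfl⟩
  refine Finset.mem_filter.2 ⟨Finset.mem_univ _, ?_⟩
  simp only [wordAt, List.get_ofFn, zero_add]
  exact hi.2

theorem length_flatten_of_forall₂_hammingClose {r : ℕ → ℝ} {vs ws : List (List A)}
    (h : List.Forall₂ (fun v w => HammingClose v w (r w.length)) vs ws) :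
    vs.flatten.length = ws.flatten.length := by
  induction h with
  | nil => rfl
  | cons h _ ih => simp [h.length_eq, ih]

/-- Since `R` preserves total length, the modified copies of `ws` still tile the word at multiples
of `ws.flatten.length`. -/
theorem wordAt_mem_of_forall₂_replicate {R : List A → List A → Prop} {ws : List (List A)}
    (hR : ∀ vs, List.Forall₂ R vs ws → vs.flatten.length = ws.flatten.length) (k : ℕ)
    {x : ℤ → A} {i : ℤ} {vs : List (List A)}
    (h : List.Forall₂ R vs (List.replicate k ws).flatten)
    (hx : wordAt x i vs.flatten.length = vs.flatten) {q : ℕ} (hq : q < k) :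
    wordAt x (i + (q * ws.flatten.length : ℕ)) ws.flatten.length ∈
      {p | ∃ us, List.Forall₂ R us ws ∧ us.flatten = p} := by
  induction k generalizing i vs q with
  | zero => omega
  | succ k ih =>
    rw [List.replicate_succ, List.flatten_cons] at h
    have h1 := List.forall₂_take_append _ _ _ h
    have h2 := List.forall₂_drop_append _ _ _ h
    rw [← List.take_append_drop ws.length vs, List.flatten_append] at hx
    obtain ⟨hx1, hx2⟩ := wordAt_eq_append hx
    rw [hR _ h1] at hx1 hx2
    cases q with
    | zero => exact ⟨_, h1, by simpa using hx1.symm⟩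
    | succ q =>
      have := ih h2 hx2 (Nat.lt_of_succ_lt_succ hq)
      rwa [add_assoc, ← Nat.cast_add, add_comm, Nat.add_comm, ← Nat.succ_mul, add_comm] at this

end Words

namespace Subshift

variable {A : Type*} [TopologicalSpace A]

theorem mem_language_iff {X : Subshift A ℤ} {w : List A} :
    w ∈ X.language ↔ ∃ x ∈ X.carrier, wordAt x 0 w.length = w := by
  constructor
  · rintro ⟨x, hx, i, h⟩
    refine ⟨shift i x, X.mapsTo i hx, ?_⟩
    rw [wordAt_shift, wordAt]
    conv_rhs => rw [← List.ofFn_get w]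
    congr 1
    funext j
    simpa using h j
  · rintro ⟨x, hx, h⟩
    refine ⟨x, hx, 0, fun j => ?_⟩
    have : w.get j = (wordAt x 0 w.length).get (j.cast (by simp)) := by
      simp only [List.get_eq_getElem]
      simp [h]
    rw [this]
    simp only [wordAt, List.get_ofFn, zero_add]
    rfl

theorem wordAt_mem_language {X : Subshift A ℤ} {x : ℤ → A} (hx : x ∈ X.carrier) (i : ℤ) (n : ℕ) :
    wordAt x i n ∈ X.language :=
  mem_language_iff.2 ⟨shift i x, X.mapsTo i hx, by simp [wordAt_shift]⟩

theorem mem_language_of_infix {X : Subshift A ℤ} {v w : List A} (hw : w ∈ X.language)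
    (h : v <:+: w) : v ∈ X.language := by
  obtain ⟨s, t, rfl⟩ := h
  obtain ⟨x, hx, h⟩ := mem_language_iff.1 hw
  have := (wordAt_eq_append (wordAt_eq_append h).1).2
  rw [← this]
  exact wordAt_mem_language hx _ _

theorem language_mono {X Y : Subshift A ℤ} (h : Y.carrier ⊆ X.carrier) :
    Y.language ⊆ X.language := by
  rintro w ⟨x, hx, hw⟩
  exact ⟨x, h hx, hw⟩

end Subshift

variable {A : Type*} [TopologicalSpace A] [DiscreteTopology A]

theorem isClopen_setOf_wordAt (i : ℤ) (n : ℕ) (P : Set (List A)) [Finite A] :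
    IsClopen {x : ℤ → A | wordAt x i n ∈ P} := by
  have hc : Continuous fun (x : ℤ → A) (j : Fin n) => x (i + (j : ℕ)) := by fun_prop
  exact (isClopen_discrete {f : Fin n → A | List.ofFn f ∈ P}).preimage hc

end SymbolicDynamics.FullShift

/-! ### Modified concatenations in the measure center -/

namespace SymbolicDynamics.FullShift.Subshift

variable {A : Type*} [Finite A] [TopologicalSpace A] [DiscreteTopology A]
  [MeasurableSpace A] [BorelSpace A]

/-- Words of `X` can be modified so that their concatenation lies in the language of the measure
center. -/
theorem HasAlmostSpecification.exists_flatten_mem_language_measureCenter {X : Subshift A ℤ}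
    {g : ℕ → ℝ} (hX : X.HasAlmostSpecification g) {ws : List (List A)} (hne : ws ≠ [])
    (hws : ∀ w ∈ ws, w ∈ X.language) :
    ∃ vs : List (List A), List.Forall₂ (fun v w => HammingClose v w (g w.length)) vs ws ∧
      vs.flatten ∈ X.measureCenter.language := by
  set R : List A → List A → Prop := fun v w => HammingClose v w (g w.length) with hRdef
  set N := ws.flatten.length with hN
  set P : Set (List A) := {p | ∃ us, List.Forall₂ R us ws ∧ us.flatten = p} with hP
  have hR : ∀ vs, List.Forall₂ R vs ws → vs.flatten.length = N :=
    fun vs h => length_flatten_of_forall₂_hammingClose h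
  -- the points in which every window contains a word of `P`
  let W : ℤ → Set (ℤ → A) := fun i => ⋃ j ∈ Finset.range (N + 1), {x | wordAt x (i + (j : ℕ)) N ∈ P}
  have hW : ∀ i, IsClosed (W i) := fun i =>
    isClosed_biUnion_finset fun j _ => (isClopen_setOf_wordAt _ _ _).isClosed
  have hWshift : ∀ n i x, x ∈ W (n + i) → shift n x ∈ W i := fun n i x h => by
    simpa only [W, Set.mem_iUnion, Set.mem_ofPred_eq, wordAt_shift, add_assoc] using h
  -- Imposing the condition on the windows at all `i` makes the set shift-invariant.
  let Y : Subshift A ℤ :=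
    { carrier := X.carrier ∩ ⋂ i, W i
      isClosed := X.isClosed.inter (isClosed_iInter hW)
      mapsTo := fun n x hx => ⟨X.mapsTo n hx.1,
        Set.mem_iInter.2 fun i => hWshift n i x (Set.mem_iInter.1 hx.2 _)⟩ }
  have hY : Y.carrier.Nonempty := by
    refine X.isClosed.isCompact.inter_iInter_nonempty W hW fun s => ?_
    obtain ⟨m, hm⟩ : ∃ m : ℕ, ∀ i ∈ s, i.natAbs ≤ m :=
      ⟨s.sup Int.natAbs, fun i hi => Finset.le_sup (f := Int.natAbs) hi⟩
    -- After the shift by `m`, windows start at `p` between `0` and `2 * m`; the block chosen below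
    -- has index at most `p / N + 1`, so `2 * m + 2` copies suffice.
    obtain ⟨vs, hvs, hmem⟩ := hX.2 (List.replicate (2 * m + 2) ws).flatten
      (by simpa [List.replicate_succ] using fun h => absurd h hne) (by simpa using hws)
    obtain ⟨x, hx, hxv⟩ := mem_language_iff.1 hmem
    have hvs' : List.Forall₂ R vs (List.replicate (2 * m + 2) ws).flatten :=
      hvs.imp fun _ _ h => h.2
    refine ⟨shift (m : ℤ) x, X.mapsTo _ hx, Set.mem_iInter₂.2 fun i hi => hWshift _ _ _ ?_⟩
    have him := hm i hi
    obtain ⟨p, hp⟩ : ∃ p : ℕ, (m : ℤ) + i = p := ⟨((m : ℤ) + i).toNat, by omega⟩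
    -- The first multiple of `N` beyond `p` starts a block; the case `N = 0` is trivial.
    obtain ⟨q, hq, j, hj, hqj⟩ : ∃ q < 2 * m + 2, ∃ j ≤ N,
        wordAt x ((p : ℤ) + j) N = wordAt x (0 + (q * N : ℕ)) N := by
      rcases Nat.eq_zero_or_pos N with h0 | hpos
      · exact ⟨0, by omega, 0, by omega, by simp [wordAt, h0]⟩
      · refine ⟨p / N + 1, ?_, N - p % N, Nat.sub_le _ _, ?_⟩
        · have := Nat.div_le_self p N
          omega
        · have h1 := Nat.div_add_mod p N
          have h2 := Nat.mod_lt p hpos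
          have h3 : p + (N - p % N) = (p / N + 1) * N := by
            rw [add_mul, one_mul, mul_comm]
            omega
          rw [zero_add, ← h3, Nat.cast_add]
    refine Set.mem_biUnion (Finset.mem_coe.2 (Finset.mem_range.2 (Nat.lt_succ_of_le hj))) ?_
    rw [Set.mem_ofPred_eq, hp, hqj]
    exact wordAt_mem_of_forall₂_replicate hR (2 * m + 2) hvs' hxv hq
  obtain ⟨y, hyY, hy⟩ := X.exists_mem_measureCenter Y Set.inter_subset_left hY
  obtain ⟨j, -, us, hus, h⟩ : ∃ j ∈ Finset.range (N + 1), wordAt y (0 + (j : ℕ)) N ∈ P := by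
    simpa only [W, Set.mem_iUnion, exists_prop, Set.mem_ofPred_eq] using Set.mem_iInter.1 hyY.2 0
  exact ⟨us, hus, h ▸ wordAt_mem_language hy _ _⟩

end SymbolicDynamics.FullShift.Subshift

/-! ### Frequent words survive few mistakes -/

namespace SymbolicDynamics.FullShift

/-- If `u` occurs at many positions of `x`, then changing `x` at few positions does not destroy
all of the occurrences. -/
theorem card_occurrences_le {A : Type*} [DecidableEq A] {x y : ℤ → A} {u : List A} {n : ℕ}
    (h : ¬ u <:+: wordAt y 0 (n + u.length)) :
    ((Finset.range n).filter fun i : ℕ => wordAt x i u.length = u).card ≤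
      u.length * ((Finset.range (n + u.length)).filter fun i : ℕ => y i ≠ x i).card := by
  have key : ∀ i ∈ (Finset.range n).filter fun i : ℕ => wordAt x i u.length = u,
      ∃ k < u.length, y (i + k : ℕ) ≠ x (i + k : ℕ) := by
    intro i hi
    rw [Finset.mem_filter, Finset.mem_range] at hi
    by_contra! hc
    refine h ?_
    have : wordAt y i u.length = u := by
      rw [← hi.2, length_wordAt, wordAt_eq_iff]
      exact_mod_cast hc
    have hinf := wordAt_infix y (i := 0) (n := n + u.length) (k := i) (m := u.length) (by omega)
    rwa [zero_add, this] at hinf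
  choose! k hk hne using key
  rw [← Finset.card_range u.length, ← Finset.card_product, Finset.card_range]
  -- Each occurrence is charged to its offset and position of a mistake; their difference recovers
  -- `i`.
  refine Finset.card_le_card_of_injOn (fun i => (k i, i + k i)) (fun i hi => ?_) ?_
  · have h1 := hk i hi
    have h2 := hne i hi
    rw [Finset.mem_coe, Finset.mem_filter, Finset.mem_range] at hi
    simp only [Finset.mem_coe, Finset.mem_product, Finset.mem_filter, Finset.mem_range]
    exact ⟨h1, by omega, h2⟩
  · intro i _ j _ hij
    simp only [Prod.mk.injEq] at hij
    omega

namespace Subshift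

variable {A : Type*} [Finite A] [TopologicalSpace A] [DiscreteTopology A]
  [MeasurableSpace A] [BorelSpace A]

/-- A word of the language of the measure center occurs with positive frequency in points of `X`. -/
theorem exists_frequency_pos [DecidableEq A] {X : Subshift A ℤ} {u : List A}
    (hu : u ∈ X.measureCenter.language) :
    ∃ c : ℝ, 0 < c ∧ ∀ n : ℕ, ∃ x ∈ X.carrier,
      n * c ≤ ((Finset.range n).filter fun i : ℕ => wordAt x i u.length = u).card := by
  obtain ⟨z, hz, hzu⟩ := mem_language_iff.1 hu
  obtain ⟨μ, ⟨hμ, hT, h0⟩, hzμ⟩ := Set.mem_iUnion₂.1 hz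
  set C : Set (ℤ → A) := {x | wordAt x 0 u.length ∈ ({u} : Set (List A))} with hCdef
  have hC : IsClopen C := isClopen_setOf_wordAt _ _ _
  have hCm : MeasurableSet C := hC.isOpen.measurableSet
  have hpos : 0 < μ.real C :=
    ENNReal.toReal_pos ((Measure.mem_support_iff_forall z).1 hzμ C (hC.isOpen.mem_nhds hzu)).ne'
      (measure_ne_top _ _)
  refine ⟨μ.real C, hpos, fun n => ?_⟩
  have hmp : ∀ i : ℕ, MeasurePreserving (shift (i : ℤ)) μ μ :=
    fun i => measurePreserving_shift hT i
  have hint : ∀ i ∈ Finset.range n,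
      Integrable (((shift (i : ℤ)) ⁻¹' C).indicator (1 : (ℤ → A) → ℝ)) μ := fun i _ =>
    (integrable_const 1).indicator ((hmp i).measurable hCm)
  -- The number of occurrences has mean `n * μ.real C` by invariance, so some point of `X` reaches
  -- it.
  obtain ⟨x, hx, hle⟩ := exists_notMem_null_integral_le (integrable_finsetSum _ hint) h0
  refine ⟨x, not_not.1 hx, ?_⟩
  rw [integral_finsetSum _ hint] at hle
  have hi : ∀ i ∈ Finset.range n,
      ∫ a, ((shift (i : ℤ)) ⁻¹' C).indicator (1 : (ℤ → A) → ℝ) a ∂μ = μ.real C := fun i _ => by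
    rw [integral_indicator_one ((hmp i).measurable hCm), measureReal_def,
      (hmp i).measure_preimage hCm.nullMeasurableSet, measureReal_def]
  rw [Finset.sum_congr rfl hi, Finset.sum_const, Finset.card_range, nsmul_eq_mul] at hle
  refine hle.trans (le_of_eq ?_)
  rw [Finset.card_filter, Nat.cast_sum]
  refine Finset.sum_congr rfl fun i _ => ?_
  simp [Set.indicator_apply, hCdef, wordAt_shift]

/-- A word of the language of the measure center survives, somewhere in a suitable long word of `X`,
all modifications that the mistake function allows. -/
theorem exists_forall_hammingClose_infix {X : Subshift A ℤ} {g : ℕ → ℝ}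
    (hg : Tendsto (fun n : ℕ => g n / n) atTop (𝓝 0)) {u : List A}
    (hu : u ∈ X.measureCenter.language) :
    ∃ U ∈ X.language, ∀ V ∈ X.language, HammingClose V U (g U.length) → u <:+: V := by
  classical
  obtain ⟨c, hc, hfreq⟩ := exists_frequency_pos hu
  set l := u.length with hl
  -- If `u` were destroyed, then `n * c ≤ l * g (n + l)`. This bound on `g`, with `l < n`, makes the
  -- right side less than `n * c`.
  have hε : 0 < c / (2 * (l + 1)) := by positivity
  obtain ⟨m, hm⟩ := eventually_atTop.1 (hg.eventually_lt_const hε)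
  set n := m + l + 1 with hn
  obtain ⟨x, hx, hcard⟩ := hfreq n
  refine ⟨wordAt x 0 (n + l), wordAt_mem_language hx _ _, fun V hV hVU => ?_⟩
  obtain ⟨y, -, hy⟩ := mem_language_iff.1 hV
  have hlen := hVU.length_eq
  rw [length_wordAt] at hlen hVU
  rw [hlen] at hy
  rw [← hy] at hVU ⊢
  by_contra hno
  have h1 : (((Finset.range n).filter fun i : ℕ => wordAt x i u.length = u).card : ℝ) ≤
      l * g (n + l) := by
    refine le_trans (Nat.cast_le.2 (card_occurrences_le hno)) ?_
    rw [Nat.cast_mul]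
    exact mul_le_mul_of_nonneg_left hVU.card_le (Nat.cast_nonneg _)
  have h2 := hm (n + l) (by omega)
  have hpos : (0 : ℝ) < (n + l : ℕ) := by rw [Nat.cast_pos]; omega
  rw [div_lt_div_iff₀ hpos (by positivity)] at h2
  have hnl : (l : ℝ) < n := by rw [Nat.cast_lt]; omega
  have h3 : n * c ≤ l * g (n + l) := hcard.trans h1
  have hl0 : (0 : ℝ) ≤ l := Nat.cast_nonneg _
  -- Positivity of `g` allows `l * g (n + l)` to be bounded by `(l + 1) * g (n + l)`.
  have hgpos : 0 < g (n + l) := by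
    by_contra! hneg
    have : 0 < n * c := mul_pos (hl0.trans_lt hnl) hc
    nlinarith [mul_nonneg hl0 (neg_nonneg.2 hneg)]
  push_cast at h2
  nlinarith [mul_pos hc (sub_pos.2 hnl)]

end SymbolicDynamics.FullShift.Subshift

theorem mainTheorem8 {A : Type*} [Finite A] [TopologicalSpace A] [DiscreteTopology A]
    [MeasurableSpace A] [BorelSpace A] (X : Subshift A ℤ) (g : ℕ → ℝ)
    (hX : X.HasAlmostSpecification g) :
    X.measureCenter.IsIrreducible ∧ X.measureCenter.HasAlmostSpecification g := by
  refine ⟨fun u hu v hv => ?_, hX.1, fun ws hne hws => ?_⟩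
  · obtain ⟨U, hU, hUu⟩ := Subshift.exists_forall_hammingClose_infix hX.1 hu
    obtain ⟨V, hV, hVv⟩ := Subshift.exists_forall_hammingClose_infix hX.1 hv
    obtain ⟨vs, hvs, hmem⟩ := hX.exists_flatten_mem_language_measureCenter (ws := [U, V])
      (by simp) (by simp [hU, hV])
    obtain ⟨U', _, hU', h, rfl⟩ := List.forall₂_cons_right_iff.1 hvs
    obtain ⟨V', _, hV', h', rfl⟩ := List.forall₂_cons_right_iff.1 h
    obtain rfl := List.forall₂_nil_right_iff.1 h'
    rw [List.flatten_cons, List.flatten_cons, List.flatten_nil, List.append_nil] at hmem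
    have hmemX := Subshift.language_mono X.measureCenter_subset hmem
    obtain ⟨a, b, rfl⟩ := hUu U' (Subshift.mem_language_of_infix hmemX ⟨[], V', rfl⟩) hU'
    obtain ⟨a', b', rfl⟩ := hVv V' (Subshift.mem_language_of_infix hmemX ⟨_, [], List.append_nil _⟩) hV'
    -- The connecting word is what follows `u` in the modified `U`, then what precedes `v` in the
    -- modified `V`.
    exact ⟨b ++ a', Subshift.mem_language_of_infix hmem ⟨a, b', by simp⟩⟩
  · obtain ⟨vs, hvs, hmem⟩ := hX.exists_flatten_mem_language_measureCenter hne
      fun w hw => Subshift.language_mono X.measureCenter_subset (hws w hw)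
    refine ⟨vs, ?_, hmem⟩
    -- The modified words are subwords of a word of the center.
    have hall : ∀ v ∈ vs, v ∈ X.measureCenter.language := fun v hv =>
      Subshift.mem_language_of_infix hmem (List.infix_of_mem_flatten hv)
    exact (List.forall₂_and_left _ _).2 ⟨hall, hvs⟩
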